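/- Let $a,b>0$ be real numbers. There exists a constant $K=K(a,b)$, depending only on $a$ and $b$, with the following property. For every integer $n\ge 1$ and every permutation $\eta$ in the symmetric group $\mathfrak S_n$ that has at most $a$ fixed points and at most $b$ cycles of length $2$ in its cycle decomposition, if $\Pi$ is uniformly distributed on $\mathfrak S_n$ and $[\eta,\Pi]=\eta^{-1}\Pi^{-1}\eta\Pi$ denotes the commutator, then $$d_{\mathrm{TV}}\bigl(\mathcal L(\#\{i\in\{1,\dots,n\}:[\eta,\Pi](i)=i\}),\ \mathrm{Poisson}(1)\bigr)\le \frac{K}{n},$$ where $\mathcal L$ denotes the distribution of a random variable, $\mathrm{Poisson}(1)$ is the Poisson distribution with expected value $1$, and $d_{\mathrm{TV}}(\mu,\nu)=\sup_{A\subseteq\{0,1,2,\dots\}}|\mu(A)-\nu(A)|$ is the total variation distance. -/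

import Mathlib

open MeasureTheory ProbabilityTheory

/-- The total variation distance between two probability measures:
the supremum of `|μ A - ν A|` over all measurable sets `A`. -/
noncomputable def tvDist {α : Type*} [MeasurableSpace α] (μ ν : Measure α) : ℝ :=
  ⨆ A : {A : Set α // MeasurableSet A}, |μ.real A - ν.real A|

/-- For probability measures the supremum defining `tvDist` is over a bounded family. -/
theorem tvDist_bddAbove {α : Type*} [MeasurableSpace α] (μ ν : Measure α)
    [IsProbabilityMeasure μ] [IsProbabilityMeasure ν] :
    BddAbove (Set.range fun A : {A : Set α // MeasurableSet A} => |μ.real A - ν.real A|) := by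
  refine ⟨1, ?_⟩
  rintro _ ⟨A, rfl⟩
  have h1 : μ.real A ≤ 1 := measureReal_le_one
  have h2 : ν.real A ≤ 1 := measureReal_le_one
  have h3 : 0 ≤ μ.real A := measureReal_nonneg
  have h4 : 0 ≤ ν.real A := measureReal_nonneg
  exact abs_le.mpr ⟨by linarith, by linarith⟩

/-- The number of fixed points of a permutation of `{0, …, n - 1}`. -/
def numFixedPoints {n : ℕ} (σ : Equiv.Perm (Fin n)) : ℕ :=
  (Finset.univ.filter fun i => σ i = i).card

/-- The number of `2`-cycles in the cycle decomposition of a permutation. -/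
def numTwoCycles {n : ℕ} (σ : Equiv.Perm (Fin n)) : ℕ :=
  σ.cycleType.count 2

/-- The commutator `[η, π] = η⁻¹ π⁻¹ η π`. -/
def permCommutator {n : ℕ} (η π : Equiv.Perm (Fin n)) : Equiv.Perm (Fin n) :=
  η⁻¹ * π⁻¹ * η * π

/-- The distribution of the number of fixed points of `[η, Π]`, where `Π` is uniformly
distributed on the symmetric group. -/
noncomputable def commutatorFixedPointsLaw {n : ℕ} (η : Equiv.Perm (Fin n)) : Measure ℕ :=
  ((PMF.uniformOfFintype (Equiv.Perm (Fin n))).map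
    fun π => numFixedPoints (permCommutator η π)).toMeasure

/-! The proof is Stein's method with an explicit coupling. The fixed points of `[η, π]` are the
points `x` with `π (η x) = η (π x)`; let `W` be their number. For a set `A`, a solution `f` of `f (k
+ 1) - k * f k = 1_A(k) - Poisson(1)(A)` satisfies `|f| ≤ 3`, so it suffices that `E[f (W + 1) - W
f(W)] = O(1/n)`.

Write `W` as a sum of indicators and split by `y = π x`. For `x`, `y` moved by `η`, the event is
that `π` lies in `arcMaps η x y`, of probability `1/(n(n-1))`. Such a `π` is turned into a uniform
permutation `σ` by two random transpositions on the left (`sum_perm_eq_sum_arcMaps`). The forced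
commuting point `x` accounts for `W(π) ≈ W(σ) + 1`, and the error counts commuting points close to
the few places where `π` and `σ` differ (`abs_card_commutingPoints_sub_le`).

Averaged over `x` and `y`, this error is `O(1/n)` provided that `E W` and `E W²` are bounded and
that the expected number of `x` with `x` and `η x` both commuting is `O(1/n)`. That last estimate is
where few 2-cycles are needed. Few fixed points make the number of pairs `(x, y)` close to `n(n-1)`,
and make the fixed `x` contribute only `O(1/n)`. -/

section Combinatorics

open Finset Equiv

variable {α : Type*} [Fintype α] [DecidableEq α]

/-! ### Permutations with prescribed images, and the transposition coupling -/

/-- The points at which `π` commutes with `η`, that is, the fixed points of `[η, π]`. -/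
def commutingPoints (η π : Perm α) : Finset α :=
  univ.filter fun x => π (η x) = η (π x)

theorem mem_commutingPoints {η π : Perm α} {x : α} :
    x ∈ commutingPoints η π ↔ π (η x) = η (π x) := by
  simp [commutingPoints]

/-- The permutations that map `x` to `y` and `η x` to `η y`. -/
def arcMaps (η : Perm α) (x y : α) : Finset (Perm α) :=
  univ.filter fun π => π x = y ∧ π (η x) = η y

theorem mem_arcMaps {η π : Perm α} {x y : α} :
    π ∈ arcMaps η x y ↔ π x = y ∧ π (η x) = η y := by
  simp [arcMaps]

/-- Composing with the involution `swap w v` matches the fibre `π p = v` of `T` with the fibre `π p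
= w`. The set `Y` collects the values barred from being the image of `p`. -/
theorem sum_eq_sum_swap_mul (T : Finset (Perm α)) (Y : Finset α) (p w : α)
    (hp : ∀ π ∈ T, π p ∉ Y) (hT : ∀ π ∈ T, ∀ v ∉ Y, swap w v * π ∈ T) (g : Perm α → ℝ) :
    ∑ π ∈ T, g π = ∑ v ∈ Yᶜ, ∑ π ∈ T.filter (fun π => π p = w), g (swap w v * π) := by
  rw [← sum_fiberwise_of_maps_to (t := Yᶜ) (g := fun π : Perm α => π p)
    (fun π hπ => by simpa using hp π hπ)]
  refine sum_congr rfl fun v hv => ?_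
  have hv' : v ∉ Y := by simpa using hv
  refine sum_bij' (fun π _ => swap w v * π) (fun π _ => swap w v * π) ?_ ?_ ?_ ?_ ?_
  · intro π hπ
    simp only [mem_filter] at hπ ⊢
    exact ⟨hT π hπ.1 v hv', by simp [hπ.2]⟩
  · intro π hπ
    simp only [mem_filter] at hπ ⊢
    exact ⟨hT π hπ.1 v hv', by simp [hπ.2]⟩
  · intro π _; simp [← mul_assoc]
  · intro π _; simp [← mul_assoc]
  · intro π _; simp [← mul_assoc]

/-- This is the coupling: a uniform `π` in `arcMaps η x y` with independent uniform `u` and `v ≠ y`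
yields a uniform permutation. Two applications of `sum_eq_sum_swap_mul` first release the image of
`x`, then that of `η x`. -/
theorem sum_perm_eq_sum_arcMaps (η : Perm α) {x y : α} (hx : η x ≠ x) (hy : η y ≠ y)
    (g : Perm α → ℝ) :
    ∑ π, g π = ∑ u, ∑ v ∈ univ.erase y, ∑ π ∈ arcMaps η x y,
      g (swap y u * (swap (η y) v * π)) := by
  rw [sum_eq_sum_swap_mul univ ∅ x y (by simp) (by simp) g]
  simp only [compl_empty]
  refine sum_congr rfl fun u _ => ?_
  rw [sum_eq_sum_swap_mul (univ.filter fun π : Perm α => π x = y) {y} (η x) (η y)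
    _ _ (fun π => g (swap y u * π))]
  · have h1 : ({y} : Finset α)ᶜ = univ.erase y := by ext; simp
    have h2 : ((univ.filter fun π : Perm α => π x = y).filter fun π => π (η x) = η y)
        = arcMaps η x y := by ext; simp [arcMaps]
    rw [h1, h2]
  · intro π hπ
    simp only [mem_filter, mem_univ, true_and, mem_singleton] at hπ ⊢
    rw [← hπ]
    exact fun h => hx (π.injective h)
  · intro π hπ v hv
    simp only [mem_filter, mem_univ, true_and, mem_singleton] at hπ hv ⊢
    rw [Perm.mul_apply, hπ]
    exact swap_apply_of_ne_of_ne (Ne.symm hy) (Ne.symm hv)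

theorem sum_arcMaps_const (η : Perm α) (x y : α) (g : Perm α → ℝ) :
    (Fintype.card α : ℝ) * ((Fintype.card α : ℝ) - 1) * ∑ π ∈ arcMaps η x y, g π
      = ∑ _u : α, ∑ _v ∈ univ.erase y, ∑ π ∈ arcMaps η x y, g π := by
  have : 0 < Fintype.card α := Fintype.card_pos_iff.mpr ⟨x⟩
  simp only [sum_const, nsmul_eq_mul, card_erase_of_mem (mem_univ y), card_univ]
  rw [Nat.cast_sub this]
  push_cast
  ring

theorem card_arcMaps (η : Perm α) {x y : α} (hx : η x ≠ x) (hy : η y ≠ y) :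
    (Fintype.card α : ℝ) * ((Fintype.card α : ℝ) - 1) * (arcMaps η x y).card
      = Fintype.card (Perm α) := by
  have h1 := sum_arcMaps_const η x y (fun _ => (1 : ℝ))
  have h2 := sum_perm_eq_sum_arcMaps η hx hy (fun _ => (1 : ℝ))
  rw [← h2] at h1
  simpa using h1

/-- The hypotheses make `x, η x, η (η x)` distinct, and likewise for `y`, so three independent
images are prescribed. -/
theorem card_arcMaps_filter (η : Perm α) {x y : α} (hx : η x ≠ x) (hy : η y ≠ y)
    (hx2 : η (η x) ≠ x) (hy2 : η (η y) ≠ y) :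
    (Fintype.card α : ℝ) * ((Fintype.card α : ℝ) - 1) * ((Fintype.card α : ℝ) - 2) *
      ((arcMaps η x y).filter fun π => π (η (η x)) = η (η y)).card
      = Fintype.card (Perm α) := by
  have h := sum_eq_sum_swap_mul (arcMaps η x y) {y, η y} (η (η x)) (η (η y)) ?_ ?_ (fun _ => (1 : ℝ))
  · have hc : (({y, η y} : Finset α)ᶜ.card : ℝ) = (Fintype.card α : ℝ) - 2 := by
      have h2 := card_add_card_compl ({y, η y} : Finset α)
      rw [card_pair (Ne.symm hy)] at h2
      rw [← h2]; push_cast; ring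
    simp only [sum_const, nsmul_eq_mul, mul_one, hc] at h
    rw [← card_arcMaps η hx hy, h]
    ring
  · intro π hπ
    rw [mem_arcMaps] at hπ
    simp only [mem_insert, mem_singleton, not_or]
    refine ⟨fun h => hx2 (π.injective (h.trans hπ.1.symm)), fun h => hx ?_⟩
    exact η.injective (π.injective (h.trans hπ.2.symm))
  · intro π hπ v hv
    rw [mem_arcMaps] at hπ ⊢
    simp only [mem_insert, mem_singleton, not_or] at hv
    rw [Perm.mul_apply, Perm.mul_apply, hπ.1, hπ.2]
    refine ⟨swap_apply_of_ne_of_ne (Ne.symm hy2) (Ne.symm hv.1), ?_⟩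
    exact swap_apply_of_ne_of_ne (fun h => hy (η.injective h).symm) (Ne.symm hv.2)

theorem sum_sum_arcMaps (η : Perm α) {x : α} (hx : η x ≠ x) (h : Perm α → ℝ) :
    ∑ y ∈ univ.filter (fun y => η y ≠ y), ∑ π ∈ arcMaps η x y, h π
      = ∑ π, if x ∈ commutingPoints η π then h π else 0 := by
  rw [← sum_filter, ← sum_fiberwise_of_maps_to (t := univ.filter (fun y => η y ≠ y))
    (g := fun π : Perm α => π x)]
  · refine sum_congr rfl fun y _ => sum_congr ?_ fun _ _ => rfl
    ext π
    simp only [mem_arcMaps, mem_filter, mem_univ, true_and, mem_commutingPoints]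
    constructor
    · rintro ⟨rfl, h⟩; exact ⟨h, rfl⟩
    · rintro ⟨h, rfl⟩; exact ⟨rfl, h⟩
  · intro π hπ
    simp only [mem_filter, mem_univ, true_and, mem_commutingPoints] at hπ ⊢
    rw [← hπ]
    exact fun h => hx (π.injective h)

/-! ### Effect of the two transpositions on the number of commuting points -/

/-- The indicators that `z` and its preimage under `η` are commuting points. -/
noncomputable def nearIndicator (η π : Perm α) (z : α) : ℝ :=
  (if z ∈ commutingPoints η π then 1 else 0) + if η⁻¹ z ∈ commutingPoints η π then 1 else 0

theorem nearIndicator_nonneg (η π : Perm α) (z : α) : 0 ≤ nearIndicator η π z := by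
  unfold nearIndicator; positivity

theorem nearIndicator_le_two (η π : Perm α) (z : α) : nearIndicator η π z ≤ 2 := by
  unfold nearIndicator; split_ifs <;> norm_num

theorem sum_nearIndicator (η π : Perm α) :
    ∑ z, nearIndicator η π z = 2 * (commutingPoints η π).card := by
  have h : ∑ z, (if η⁻¹ z ∈ commutingPoints η π then (1 : ℝ) else 0)
      = ∑ z, if z ∈ commutingPoints η π then (1 : ℝ) else 0 :=
    Equiv.sum_comp η⁻¹ fun z => if z ∈ commutingPoints η π then (1 : ℝ) else 0
  simp only [nearIndicator, sum_add_distrib, h]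
  simp
  ring

/-- The commuting points that are affected by a change of `π` on `D`. -/
def affectedPoints (η π : Perm α) (D : Finset α) : Finset α :=
  (commutingPoints η π).filter fun z => z ∈ D ∨ η z ∈ D

/-- Whether `z` commutes depends only on the values at `z` and `η z`, so all other points cancel. -/
theorem card_commutingPoints_sub (η π π' : Perm α) (D : Finset α) (hD : ∀ z ∉ D, π z = π' z) :
    ((commutingPoints η π').card : ℝ) - (commutingPoints η π).card
      = (affectedPoints η π' D).card - (affectedPoints η π D).card := by
  have h (σ : Perm α) := card_filter_add_card_filter_not (s := commutingPoints η σ)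
    (fun z => z ∈ D ∨ η z ∈ D)
  have he : (commutingPoints η π').filter (fun z => ¬ (z ∈ D ∨ η z ∈ D))
      = (commutingPoints η π).filter (fun z => ¬ (z ∈ D ∨ η z ∈ D)) := by
    ext z
    simp only [mem_filter, mem_commutingPoints, not_or]
    constructor
    · rintro ⟨h1, h2, h3⟩; exact ⟨by rw [hD _ h2, hD _ h3, h1], h2, h3⟩
    · rintro ⟨h1, h2, h3⟩; exact ⟨by rw [← hD _ h2, ← hD _ h3, h1], h2, h3⟩
  have h1 := h π
  have h2 := h π'
  rw [he] at h2
  unfold affectedPoints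
  rw [← h1, ← h2]
  push_cast
  ring

theorem card_affectedPoints_le (η π : Perm α) (D : Finset α) :
    ((affectedPoints η π D).card : ℝ) ≤ ∑ z ∈ D, nearIndicator η π z := by
  have hsub : affectedPoints η π D ⊆ D.filter (· ∈ commutingPoints η π) ∪
      (D.filter (fun z => η⁻¹ z ∈ commutingPoints η π)).image ⇑η⁻¹ := by
    intro z hz
    simp only [affectedPoints, mem_filter, mem_union, mem_image] at hz ⊢
    rcases hz.2 with h | h
    · exact Or.inl ⟨h, hz.1⟩
    · exact Or.inr ⟨η z, ⟨h, by simpa using hz.1⟩, by simp⟩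
  have h1 := (card_le_card hsub).trans (card_union_le _ _)
  have h2 : ((D.filter (fun z => η⁻¹ z ∈ commutingPoints η π)).image ⇑η⁻¹).card
      ≤ (D.filter (fun z => η⁻¹ z ∈ commutingPoints η π)).card := card_image_le
  have h3 : ((affectedPoints η π D).card : ℝ) ≤ (D.filter (· ∈ commutingPoints η π)).card
      + (D.filter (fun z => η⁻¹ z ∈ commutingPoints η π)).card := by exact_mod_cast h1.trans (by omega)
  refine h3.trans (le_of_eq ?_)
  simp only [nearIndicator, sum_add_distrib, card_filter]
  push_cast
  rfl

theorem sum_insert_le {β : Type*} [DecidableEq β] {z : β} {D : Finset β} {g : β → ℝ} (hg : ∀ z, 0 ≤ g z) :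
    ∑ w ∈ insert z D, g w ≤ g z + ∑ w ∈ D, g w := by
  by_cases h : z ∈ D
  · rw [insert_eq_of_mem h]; linarith [hg z]
  · rw [sum_insert h]

theorem swap_mul_swap_mul_apply_eq {η π : Perm α} {x y u v z : α} (hπ : π ∈ arcMaps η x y)
    (hz : z ∉ ({x, η x, π⁻¹ u, π⁻¹ v} : Finset α)) :
    (swap y u * (swap (η y) v * π)) z = π z := by
  rw [mem_arcMaps] at hπ
  simp only [mem_insert, mem_singleton, not_or, Perm.eq_inv_iff_eq] at hz
  obtain ⟨h1, h2, h3, h4⟩ := hz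
  have h5 : π z ≠ y := fun h => h1 (π.injective (h.trans hπ.1.symm))
  have h6 : π z ≠ η y := fun h => h2 (π.injective (h.trans hπ.2.symm))
  rw [Perm.mul_apply, Perm.mul_apply, swap_apply_of_ne_of_ne h6 h4, swap_apply_of_ne_of_ne h5 h3]

/-- The exceptional set is now located by the modified permutation alone. Since that permutation is
uniform, its share of the error can be averaged without reference to `π`. -/
theorem swap_mul_swap_mul_apply_eq' {η π : Perm α} {x y u v z : α} (hy : η y ≠ y) (hv : v ≠ y) (hπ : π ∈ arcMaps η x y)
    (hz : z ∉ ({x, η x, (swap y u * (swap (η y) v * π))⁻¹ y,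
      (swap y u * (swap (η y) v * π))⁻¹ (η y)} : Finset α)) :
    (swap y u * (swap (η y) v * π)) z = π z := by
  have hπ' := mem_arcMaps.mp hπ
  simp only [mem_insert, mem_singleton, not_or, Perm.eq_inv_iff_eq] at hz
  obtain ⟨h1, h2, h3, h4⟩ := hz
  have h5 : π z ≠ y := fun h => h1 (π.injective (h.trans hπ'.1.symm))
  have h6 : π z ≠ η y := fun h => h2 (π.injective (h.trans hπ'.2.symm))
  simp only [Perm.mul_apply, swap_apply_def] at *
  split_ifs at * <;> simp_all

theorem affectedPoints_mono (η π : Perm α) {D D' : Finset α} (h : D ⊆ D') :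
    affectedPoints η π D ⊆ affectedPoints η π D' := by
  intro z hz
  simp only [affectedPoints, mem_filter] at hz ⊢
  exact ⟨hz.1, hz.2.imp (@h _) (@h _)⟩

/-- Four exceptional points affect at most two commuting points each. This crude bound serves only
for the second moment. -/
theorem card_commutingPoints_le_add_eight {η π : Perm α} {x y : α} (u v : α)
    (hπ : π ∈ arcMaps η x y) :
    ((commutingPoints η π).card : ℝ)
      ≤ (commutingPoints η (swap y u * (swap (η y) v * π))).card + 8 := by
  set D : Finset α := {x, η x, π⁻¹ u, π⁻¹ v} with hD
  have h1 := card_commutingPoints_sub η (swap y u * (swap (η y) v * π)) π D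
    fun z hz => swap_mul_swap_mul_apply_eq hπ hz
  have h2 := (card_affectedPoints_le η π D).trans
    (sum_le_card_nsmul D _ 2 fun z _ => nearIndicator_le_two η π z)
  have h3 : (D.card : ℝ) ≤ 4 := by exact_mod_cast card_le_four
  rw [nsmul_eq_mul] at h2
  have h4 : (0 : ℝ) ≤ (affectedPoints η (swap y u * (swap (η y) v * π)) D).card := by positivity
  linarith

theorem card_affectedPoints_quad_le (η π : Perm α) (x u v : α) :
    ((affectedPoints η π {x, η x, π⁻¹ u, π⁻¹ v}).card : ℝ) ≤
      1 + ((if η x ∈ commutingPoints η π then 1 else 0)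
        + (if η⁻¹ x ∈ commutingPoints η π then 1 else 0)
        + nearIndicator η π (π⁻¹ u) + nearIndicator η π (π⁻¹ v)) := by
  have hsub : affectedPoints η π {x, η x, π⁻¹ u, π⁻¹ v} ⊆
      {x} ∪ (({η x} : Finset α).filter (· ∈ commutingPoints η π) ∪
        (({η⁻¹ x} : Finset α).filter (· ∈ commutingPoints η π) ∪
          affectedPoints η π {π⁻¹ u, π⁻¹ v})) := by
    intro z hz
    simp only [affectedPoints, mem_filter, mem_union, mem_insert, mem_singleton] at hz ⊢
    obtain ⟨hz, h⟩ := hz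
    have h5 : η z = x ↔ z = η⁻¹ x := by rw [Perm.eq_inv_iff_eq]
    have h6 : η z = η x ↔ z = x := η.injective.eq_iff
    rw [h5, h6] at h
    tauto
  have h1 := card_le_card hsub
  have h2 := card_union_le {x} (({η x} : Finset α).filter (· ∈ commutingPoints η π) ∪
        (({η⁻¹ x} : Finset α).filter (· ∈ commutingPoints η π) ∪
          affectedPoints η π {π⁻¹ u, π⁻¹ v}))
  have h3 := card_union_le (({η x} : Finset α).filter (· ∈ commutingPoints η π))
        (({η⁻¹ x} : Finset α).filter (· ∈ commutingPoints η π) ∪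
          affectedPoints η π {π⁻¹ u, π⁻¹ v})
  have h4 := card_union_le (({η⁻¹ x} : Finset α).filter (· ∈ commutingPoints η π))
          (affectedPoints η π {π⁻¹ u, π⁻¹ v})
  have h5 := card_affectedPoints_le η π {π⁻¹ u, π⁻¹ v}
  have h6 : ∑ z ∈ ({π⁻¹ u, π⁻¹ v} : Finset α), nearIndicator η π z
      ≤ nearIndicator η π (π⁻¹ u) + nearIndicator η π (π⁻¹ v) := by
    refine (sum_insert_le (nearIndicator_nonneg η π)).trans ?_
    rw [sum_singleton]
  have h7 (z : α) : ((({z} : Finset α).filter (· ∈ commutingPoints η π)).card : ℝ)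
      = if z ∈ commutingPoints η π then 1 else 0 := by
    rw [card_filter, sum_singleton]; push_cast; rfl
  rw [← h7, ← h7]
  rw [card_singleton] at h2
  have h8 : ((affectedPoints η π {x, η x, π⁻¹ u, π⁻¹ v}).card : ℝ) ≤
      1 + ((({η x} : Finset α).filter (· ∈ commutingPoints η π)).card
        + ((({η⁻¹ x} : Finset α).filter (· ∈ commutingPoints η π)).card
        + (affectedPoints η π {π⁻¹ u, π⁻¹ v}).card)) := by
    exact_mod_cast (by omega)
  linarith

/-- The point `x` commutes for `π` and is affected, so the affected count for `π` is at least 1 and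
at most 1 plus the other commuting points nearby. The `+ 1` removes this 1, and only error terms
remain on either side. -/
theorem abs_card_commutingPoints_sub_le {η π : Perm α} {x y u v : α}
    (hy : η y ≠ y) (hv : v ≠ y) (hπ : π ∈ arcMaps η x y) :
    |((commutingPoints η π).card : ℝ)
      - ((commutingPoints η (swap y u * (swap (η y) v * π))).card + 1)| ≤
      (nearIndicator η (swap y u * (swap (η y) v * π)) x
        + nearIndicator η (swap y u * (swap (η y) v * π)) (η x)
        + nearIndicator η (swap y u * (swap (η y) v * π))
            ((swap y u * (swap (η y) v * π))⁻¹ y)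
        + nearIndicator η (swap y u * (swap (η y) v * π))
            ((swap y u * (swap (η y) v * π))⁻¹ (η y)))
      + ((if η x ∈ commutingPoints η π then 1 else 0)
        + (if η⁻¹ x ∈ commutingPoints η π then 1 else 0)
        + nearIndicator η π (π⁻¹ u) + nearIndicator η π (π⁻¹ v)) := by
  have hD1 := fun z => @swap_mul_swap_mul_apply_eq α _ _ η π x y u v z hπ
  have hD2 := fun z => @swap_mul_swap_mul_apply_eq' α _ _ η π x y u v z hy hv hπ
  set σ := swap y u * (swap (η y) v * π) with hσ
  -- `x` is inserted because `π` and `σ` may agree there, yet it must be counted.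
  set D : Finset α := insert x (univ.filter fun z => σ z ≠ π z) with hD
  have hsub1 : D ⊆ {x, η x, π⁻¹ u, π⁻¹ v} := by
    intro z hz
    rw [hD, mem_insert, mem_filter] at hz
    by_contra h
    rcases hz with rfl | hz
    · simp at h
    · exact hz.2 (hD1 z h)
  have hsub2 : D ⊆ {x, η x, σ⁻¹ y, σ⁻¹ (η y)} := by
    intro z hz
    rw [hD, mem_insert, mem_filter] at hz
    by_contra h
    rcases hz with rfl | hz
    · simp at h
    · exact hz.2 (hD2 z h)
  have h1 := card_commutingPoints_sub η σ π D fun z hz => by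
    simp only [hD, mem_insert, mem_filter, mem_univ, true_and, not_or, not_not] at hz
    exact hz.2
  have h2 : ((affectedPoints η π D).card : ℝ) ≤ (affectedPoints η π {x, η x, π⁻¹ u, π⁻¹ v}).card :=
    by exact_mod_cast card_le_card (affectedPoints_mono η π hsub1)
  have h3 := card_affectedPoints_quad_le η π x u v
  have h4 : (1 : ℝ) ≤ (affectedPoints η π D).card := by
    have hx : x ∈ affectedPoints η π D := by
      have h := mem_arcMaps.mp hπ
      simp only [affectedPoints, mem_filter, mem_commutingPoints]
      exact ⟨by rw [h.1, h.2], Or.inl (by simp [hD])⟩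
    exact_mod_cast card_pos.mpr ⟨x, hx⟩
  have h5 : ((affectedPoints η σ D).card : ℝ) ≤ nearIndicator η σ x + (nearIndicator η σ (η x)
      + (nearIndicator η σ (σ⁻¹ y) + nearIndicator η σ (σ⁻¹ (η y)))) := by
    refine (card_affectedPoints_le η σ D).trans ((sum_le_sum_of_subset_of_nonneg hsub2
      fun z _ _ => nearIndicator_nonneg η σ z).trans ?_)
    have hg := nearIndicator_nonneg η σ
    refine (sum_insert_le hg).trans (add_le_add le_rfl ((sum_insert_le hg).trans
      (add_le_add le_rfl ((sum_insert_le hg).trans ?_))))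
    rw [sum_singleton]
  have h6 : (0 : ℝ) ≤ (affectedPoints η σ D).card := by positivity
  rw [abs_le]
  constructor <;> linarith

theorem sum_nearIndicator_quad (η σ : Perm α) :
    ∑ x, ∑ y, (nearIndicator η σ x + nearIndicator η σ (η x) + nearIndicator η σ (σ⁻¹ y)
      + nearIndicator η σ (σ⁻¹ (η y)))
      = 8 * (Fintype.card α : ℝ) * (commutingPoints η σ).card := by
  have h1 : ∑ x, nearIndicator η σ (η x) = ∑ x, nearIndicator η σ x :=
    Equiv.sum_comp η (nearIndicator η σ)
  have h2 : ∑ y, nearIndicator η σ (σ⁻¹ y) = ∑ x, nearIndicator η σ x :=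
    Equiv.sum_comp σ⁻¹ (nearIndicator η σ)
  have h3 : ∑ y, nearIndicator η σ (σ⁻¹ (η y)) = ∑ x, nearIndicator η σ x :=
    Equiv.sum_comp (σ⁻¹ * η) (nearIndicator η σ)
  simp only [sum_add_distrib, sum_const, nsmul_eq_mul, ← mul_sum, h1, h2, h3, card_univ,
    sum_nearIndicator]
  ring

theorem sum_nearIndicator_pair (η π : Perm α) (c : ℝ) :
    ∑ u, ∑ v, (c + nearIndicator η π (π⁻¹ u) + nearIndicator η π (π⁻¹ v))
      = (Fintype.card α : ℝ) ^ 2 * c + 4 * (Fintype.card α : ℝ) * (commutingPoints η π).card := by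
  have h2 : ∑ y, nearIndicator η π (π⁻¹ y) = ∑ x, nearIndicator η π x :=
    Equiv.sum_comp π⁻¹ (nearIndicator η π)
  simp only [sum_add_distrib, sum_const, nsmul_eq_mul, ← mul_sum, h2, card_univ,
    sum_nearIndicator]
  ring

/-- The number of `x` moved by `η` such that `x` and `η x` are both commuting points. -/
noncomputable def consecutivePairs (η π : Perm α) : ℝ :=
  ∑ x ∈ univ.filter (fun x => η x ≠ x),
    if x ∈ commutingPoints η π ∧ η x ∈ commutingPoints η π then 1 else 0

theorem sum_neighbours (η π : Perm α) :
    ∑ x ∈ univ.filter (fun x => η x ≠ x), (if x ∈ commutingPoints η π then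
      ((if η x ∈ commutingPoints η π then 1 else 0)
        + (if η⁻¹ x ∈ commutingPoints η π then (1 : ℝ) else 0)) else 0)
      = 2 * consecutivePairs η π := by
  have h : ∑ x ∈ univ.filter (fun x => η x ≠ x),
      (if x ∈ commutingPoints η π ∧ η⁻¹ x ∈ commutingPoints η π then (1 : ℝ) else 0)
      = consecutivePairs η π := by
    unfold consecutivePairs
    rw [sum_filter, sum_filter, ← Equiv.sum_comp η]
    refine sum_congr rfl fun x _ => ?_
    have hi : η⁻¹ (η x) = x := by simp
    simp only [hi, ne_eq, η.injective.eq_iff, and_comm]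
  rw [two_mul]
  nth_rw 1 [← h]
  unfold consecutivePairs
  rw [← sum_add_distrib]
  refine sum_congr rfl fun x _ => ?_
  split_ifs <;> simp_all

/-- The terms in the modified permutation are summed through the coupling and give the first moment.
Among the terms in `π`, the neighbours `η x` and `η⁻¹ x` give `consecutivePairs`. The points `π⁻¹ u`
and `π⁻¹ v` give a multiple of `W`, which summation over commuting `x` raises to `W²`. -/
theorem sum_abs_card_commutingPoints_sub_le (η : Perm α) :
    ∑ x ∈ univ.filter (fun x => η x ≠ x), ∑ y ∈ univ.filter (fun y => η y ≠ y),
      ∑ u, ∑ v ∈ univ.erase y, ∑ π ∈ arcMaps η x y,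
        |((commutingPoints η π).card : ℝ)
          - ((commutingPoints η (swap y u * (swap (η y) v * π))).card + 1)|
      ≤ 8 * (Fintype.card α : ℝ) * ∑ π, ((commutingPoints η π).card : ℝ)
        + 2 * (Fintype.card α : ℝ) ^ 2 * ∑ π, consecutivePairs η π
        + 4 * (Fintype.card α : ℝ) * ∑ π, ((commutingPoints η π).card : ℝ) ^ 2 := by
  set S := univ.filter (fun x => η x ≠ x) with hS
  set n := (Fintype.card α : ℝ) with hn
  let A : α → α → Perm α → ℝ := fun x y σ => nearIndicator η σ x + nearIndicator η σ (η x)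
    + nearIndicator η σ (σ⁻¹ y) + nearIndicator η σ (σ⁻¹ (η y))
  let c : α → Perm α → ℝ := fun x π => (if η x ∈ commutingPoints η π then 1 else 0)
        + (if η⁻¹ x ∈ commutingPoints η π then 1 else 0)
  have hA (x y σ) : 0 ≤ A x y σ := by
    have := nearIndicator_nonneg η σ
    exact add_nonneg (add_nonneg (add_nonneg (this _) (this _)) (this _)) (this _)
  have hc (x π) : 0 ≤ c x π := by
    simp only [c]; positivity
  have key : ∀ x ∈ S, ∀ y ∈ S, ∑ u, ∑ v ∈ univ.erase y, ∑ π ∈ arcMaps η x y,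
        |((commutingPoints η π).card : ℝ)
          - ((commutingPoints η (swap y u * (swap (η y) v * π))).card + 1)|
      ≤ ∑ σ, A x y σ
        + ∑ π ∈ arcMaps η x y, (n ^ 2 * c x π + 4 * n * (commutingPoints η π).card) := by
    intro x hx y hy
    have hx' : η x ≠ x := by simpa [hS] using hx
    have hy' : η y ≠ y := by simpa [hS] using hy
    rw [sum_perm_eq_sum_arcMaps η hx' hy' (A x y)]
    have h2 : ∑ π ∈ arcMaps η x y, (n ^ 2 * c x π + 4 * n * (commutingPoints η π).card)
        = ∑ u, ∑ v, ∑ π ∈ arcMaps η x y,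
          (c x π + nearIndicator η π (π⁻¹ u) + nearIndicator η π (π⁻¹ v)) := by
      simp only [hn, ← sum_nearIndicator_pair]
      rw [sum_comm]
      exact sum_congr rfl fun u _ => sum_comm
    have h3 : ∑ u, ∑ v ∈ univ.erase y, ∑ π ∈ arcMaps η x y,
          (c x π + nearIndicator η π (π⁻¹ u) + nearIndicator η π (π⁻¹ v))
        ≤ ∑ u, ∑ v, ∑ π ∈ arcMaps η x y,
          (c x π + nearIndicator η π (π⁻¹ u) + nearIndicator η π (π⁻¹ v)) := by
      refine sum_le_sum fun u _ => sum_le_sum_of_subset_of_nonneg (erase_subset _ _)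
        fun v _ _ => sum_nonneg fun π _ => ?_
      exact add_nonneg (add_nonneg (hc _ _) (nearIndicator_nonneg _ _ _))
        (nearIndicator_nonneg _ _ _)
    rw [h2]
    refine le_trans ?_ (add_le_add le_rfl h3)
    simp only [← sum_add_distrib]
    refine sum_le_sum fun u _ => sum_le_sum fun v hv => sum_le_sum fun π hπ => ?_
    exact abs_card_commutingPoints_sub_le hy' (ne_of_mem_erase hv) hπ
  refine (sum_le_sum fun x hx => sum_le_sum fun y hy => key x hx y hy).trans ?_
  simp only [sum_add_distrib (s := S)]
  rw [add_assoc]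
  refine add_le_add ?_ ?_
  · have h1 : ∑ x ∈ S, ∑ y ∈ S, ∑ σ, A x y σ ≤ ∑ x, ∑ y, ∑ σ, A x y σ := by
      refine (sum_le_sum_of_subset_of_nonneg (subset_univ _) fun x _ _ => sum_nonneg fun y _ =>
        sum_nonneg fun σ _ => hA x y σ).trans (sum_le_sum fun x _ =>
          sum_le_sum_of_subset_of_nonneg (subset_univ _) fun y _ _ =>
            sum_nonneg fun σ _ => hA x y σ)
    refine h1.trans (le_of_eq ?_)
    rw [mul_sum]
    simp only [hn, ← sum_nearIndicator_quad]
    symm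
    rw [sum_comm]
    exact sum_congr rfl fun x _ => sum_comm
  · have h1 : ∑ x ∈ S, ∑ y ∈ S, ∑ π ∈ arcMaps η x y,
        (n ^ 2 * c x π + 4 * n * (commutingPoints η π).card)
        = ∑ π, ∑ x ∈ S, if x ∈ commutingPoints η π then
          (n ^ 2 * c x π + 4 * n * (commutingPoints η π).card) else 0 := by
      rw [sum_comm (s := univ)]
      refine sum_congr rfl fun x hx => ?_
      exact sum_sum_arcMaps η (by simpa [hS] using hx)
        (fun π => n ^ 2 * c x π + 4 * n * (commutingPoints η π).card)
    rw [h1, mul_sum, mul_sum, ← sum_add_distrib]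
    refine sum_le_sum fun π _ => ?_
    have h2 := sum_neighbours η π
    have h3 : ∑ x ∈ S, (if x ∈ commutingPoints η π then (1 : ℝ) else 0)
        ≤ (commutingPoints η π).card := by
      rw [← sum_filter, sum_const, nsmul_eq_mul, mul_one]
      exact_mod_cast card_le_card fun z hz => (mem_filter.mp hz).2
    have h4 : ∑ x ∈ S, (if x ∈ commutingPoints η π then
          (n ^ 2 * c x π + 4 * n * (commutingPoints η π).card) else 0)
        = n ^ 2 * ∑ x ∈ S, (if x ∈ commutingPoints η π then c x π else 0)
          + 4 * n * (commutingPoints η π).card *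
            ∑ x ∈ S, (if x ∈ commutingPoints η π then (1 : ℝ) else 0) := by
      rw [mul_sum, mul_sum, ← sum_add_distrib]
      refine sum_congr rfl fun x _ => ?_
      split_ifs <;> simp
    rw [h4, h2]
    have h5 : (0 : ℝ) ≤ 4 * n * (commutingPoints η π).card := by positivity
    have := mul_le_mul_of_nonneg_left h3 h5
    nlinarith

/-! ### Moment bounds -/

theorem sq_card_filter_le {β : Type*} [Fintype β] (p : β → Prop) [DecidablePred p] (hn : 2 ≤ Fintype.card β) :
    ((univ.filter p).card : ℝ) ^ 2 ≤ 2 * ((Fintype.card β : ℝ) * ((Fintype.card β : ℝ) - 1)) := by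
  have h1 : ((univ.filter p).card : ℝ) ≤ Fintype.card β := by
    exact_mod_cast (card_le_card (filter_subset _ _)).trans_eq card_univ
  have h2 : (2 : ℝ) ≤ Fintype.card β := by exact_mod_cast hn
  have h3 : (0 : ℝ) ≤ (univ.filter p).card := by positivity
  nlinarith

theorem card_mul_card_sub_one_pos {β : Type*} [Fintype β] (hn : 2 ≤ Fintype.card β) :
    0 < (Fintype.card β : ℝ) * ((Fintype.card β : ℝ) - 1) := by
  have h2 : (2 : ℝ) ≤ Fintype.card β := by exact_mod_cast hn
  exact mul_pos (by linarith) (by linarith)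

theorem sum_card_commutingPoints_mul (η : Perm α) (h : Perm α → ℝ) :
    ∑ π, (commutingPoints η π).card * h π
      = ∑ x ∈ univ.filter (fun x => η x ≠ x), ∑ y ∈ univ.filter (fun y => η y ≠ y),
          ∑ π ∈ arcMaps η x y, h π
        + ∑ x ∈ univ.filter (fun x => η x = x), ∑ π,
          if x ∈ commutingPoints η π then h π else 0 := by
  have h1 : ∑ π, (commutingPoints η π).card * h π
      = ∑ x, ∑ π, if x ∈ commutingPoints η π then h π else 0 := by
    rw [sum_comm]
    refine sum_congr rfl fun π _ => ?_
    rw [← sum_filter, sum_const, nsmul_eq_mul]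
    simp
  rw [h1, ← sum_filter_not_add_sum_filter univ (fun x => η x = x)]
  congr 1
  refine sum_congr rfl fun x hx => ?_
  exact (sum_sum_arcMaps η (by simpa using hx) h).symm

theorem card_mul_card_filter_apply_eq (x y : α) :
    (Fintype.card α : ℝ) * ((univ.filter fun π : Perm α => π x = y).card : ℝ)
      = Fintype.card (Perm α) := by
  have h := sum_eq_sum_swap_mul univ ∅ x y (by simp) (by simp) (fun _ => (1 : ℝ))
  simp only [sum_const, nsmul_eq_mul, mul_one, compl_empty, card_univ] at h
  exact h.symm

/-- A fixed point `x` of `η` commutes exactly when `π x` is again a fixed point of `η`. -/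
theorem card_mul_sum_fixed (η : Perm α) :
    (Fintype.card α : ℝ) * ∑ x ∈ univ.filter (fun x => η x = x), ∑ π,
        (if x ∈ commutingPoints η π then (1 : ℝ) else 0)
      = ((univ.filter fun x => η x = x).card : ℝ) ^ 2 * Fintype.card (Perm α) := by
  have h1 : ∀ x ∈ univ.filter (fun x => η x = x), (Fintype.card α : ℝ) * ∑ π,
      (if x ∈ commutingPoints η π then (1 : ℝ) else 0)
      = (univ.filter fun x => η x = x).card * Fintype.card (Perm α) := by
    intro x hx
    have hx' : η x = x := by simpa using hx
    rw [← sum_filter, ← sum_fiberwise_of_maps_to (t := univ.filter (fun y => η y = y))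
      (g := fun π : Perm α => π x), mul_sum, ← nsmul_eq_mul, ← sum_const]
    · refine sum_congr rfl fun y hy => ?_
      have hy' : η y = y := by simpa using hy
      rw [sum_const, nsmul_eq_mul, mul_one, ← card_mul_card_filter_apply_eq x y]
      congr 3
      ext π
      simp only [mem_filter, mem_univ, true_and, mem_commutingPoints, hx', and_iff_right_iff_imp]
      rintro rfl
      exact hy'.symm
    · intro π hπ
      simp only [mem_filter, mem_univ, true_and, mem_commutingPoints, hx'] at hπ ⊢
      exact hπ.symm
  rw [mul_sum, sum_congr rfl h1, sum_const, nsmul_eq_mul]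
  ring

theorem mul_sum_sum_arcMaps (η : Perm α) (h : Perm α → ℝ) :
    (Fintype.card α : ℝ) * ((Fintype.card α : ℝ) - 1) *
      ∑ x ∈ univ.filter (fun x => η x ≠ x), ∑ y ∈ univ.filter (fun y => η y ≠ y),
        ∑ π ∈ arcMaps η x y, h π
    = ∑ x ∈ univ.filter (fun x => η x ≠ x), ∑ y ∈ univ.filter (fun y => η y ≠ y),
        ∑ _u : α, ∑ _v ∈ univ.erase y, ∑ π ∈ arcMaps η x y, h π := by
  simp only [mul_sum (s := univ.filter _), sum_arcMaps_const]

theorem sum_sum_swap_mul (η : Perm α) (g : Perm α → ℝ) :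
    ∑ x ∈ univ.filter (fun x => η x ≠ x), ∑ y ∈ univ.filter (fun y => η y ≠ y),
        ∑ u, ∑ v ∈ univ.erase y, ∑ π ∈ arcMaps η x y, g (swap y u * (swap (η y) v * π))
      = ((univ.filter fun x => η x ≠ x).card : ℝ) ^ 2 * ∑ π, g π := by
  have h1 : ∀ x ∈ univ.filter (fun x => η x ≠ x), ∀ y ∈ univ.filter (fun y => η y ≠ y),
      ∑ u, ∑ v ∈ univ.erase y, ∑ π ∈ arcMaps η x y, g (swap y u * (swap (η y) v * π))
      = ∑ π, g π := fun x hx y hy =>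
    (sum_perm_eq_sum_arcMaps η (by simpa using hx) (by simpa using hy) g).symm
  rw [sum_congr rfl fun x hx => sum_congr rfl (h1 x hx)]
  simp only [sum_const, nsmul_eq_mul]
  ring

theorem sum_card_commutingPoints_le (η : Perm α) (hn : 2 ≤ Fintype.card α) :
    ∑ π, ((commutingPoints η π).card : ℝ)
      ≤ (2 + (univ.filter fun x => η x = x).card) * Fintype.card (Perm α) := by
  have h1 := sum_card_commutingPoints_mul η (fun _ => (1 : ℝ))
  have h2 := mul_sum_sum_arcMaps η (fun _ => (1 : ℝ))
  rw [sum_sum_swap_mul η (fun _ => (1 : ℝ))] at h2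
  have hP := card_mul_card_sub_one_pos hn
  have h3 : ∑ x ∈ univ.filter (fun x => η x = x), ∑ π,
      (if x ∈ commutingPoints η π then (1 : ℝ) else 0)
      ≤ ∑ x ∈ univ.filter (fun x => η x = x), ∑ _π : Perm α, (1 : ℝ) :=
    sum_le_sum fun x _ => sum_le_sum fun π _ => by split_ifs <;> norm_num
  have h4 : ∑ _π : Perm α, (1 : ℝ) = Fintype.card (Perm α) := by simp
  have h5 : ∑ x ∈ univ.filter (fun x => η x ≠ x), ∑ y ∈ univ.filter (fun y => η y ≠ y),
      ∑ π ∈ arcMaps η x y, (1 : ℝ) ≤ 2 * Fintype.card (Perm α) := by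
    refine le_of_mul_le_mul_left ?_ hP
    rw [h2, h4]
    have := mul_le_mul_of_nonneg_right (sq_card_filter_le (fun x => η x ≠ x) hn)
      (Nat.cast_nonneg (α := ℝ) (Fintype.card (Perm α)))
    linarith
  simp only [mul_one] at h1
  rw [h4, sum_const, nsmul_eq_mul] at h3
  rw [h1]
  linarith

/-- Weighting the indicator decomposition by `W` and replacing `W(π)` by `W(σ) + 8` reduces to the
first moment: `E W² ≤ 2 (E W + 8) + F E W` with `F` the number of fixed points of `η`. -/
theorem sum_sq_card_commutingPoints_le (η : Perm α) (hn : 2 ≤ Fintype.card α) :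
    ∑ π, ((commutingPoints η π).card : ℝ) ^ 2
      ≤ ((2 + (univ.filter fun x => η x = x).card) ^ 2 + 16) * Fintype.card (Perm α) := by
  have h1 := sum_card_commutingPoints_mul η (fun π => ((commutingPoints η π).card : ℝ))
  have h2 := mul_sum_sum_arcMaps η (fun π => ((commutingPoints η π).card : ℝ))
  have hP := card_mul_card_sub_one_pos hn
  have hW := sum_card_commutingPoints_le η hn
  have h3 : ∑ x ∈ univ.filter (fun x => η x = x), ∑ π,
      (if x ∈ commutingPoints η π then ((commutingPoints η π).card : ℝ) else 0)
      ≤ ∑ x ∈ univ.filter (fun x => η x = x), ∑ π, ((commutingPoints η π).card : ℝ) :=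
    sum_le_sum fun x _ => sum_le_sum fun π _ => by split_ifs <;> simp
  have h4 : ∑ π, (((commutingPoints η π).card : ℝ) + 8)
      = ∑ π, ((commutingPoints η π).card : ℝ) + 8 * Fintype.card (Perm α) := by
    simp [sum_add_distrib, mul_comm]
  have h5 : ∑ x ∈ univ.filter (fun x => η x ≠ x), ∑ y ∈ univ.filter (fun y => η y ≠ y),
      ∑ π ∈ arcMaps η x y, ((commutingPoints η π).card : ℝ)
      ≤ 2 * ∑ π, (((commutingPoints η π).card : ℝ) + 8) := by
    refine le_of_mul_le_mul_left ?_ hP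
    have h6 := sum_sum_swap_mul η (fun π => ((commutingPoints η π).card : ℝ) + 8)
    beta_reduce at h6
    have h7 : ∀ x y u v : α, ∑ π ∈ arcMaps η x y, ((commutingPoints η π).card : ℝ)
        ≤ ∑ π ∈ arcMaps η x y,
          (((commutingPoints η (swap y u * (swap (η y) v * π))).card : ℝ) + 8) :=
      fun x y u v => sum_le_sum fun π hπ => card_commutingPoints_le_add_eight u v hπ
    rw [h2]
    refine le_trans (sum_le_sum fun x _ => sum_le_sum fun y _ => sum_le_sum fun u _ =>
      sum_le_sum fun v _ => h7 x y u v) ?_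
    rw [h6]
    have := mul_le_mul_of_nonneg_right (sq_card_filter_le (fun x => η x ≠ x) hn)
      (sum_nonneg fun π (_ : π ∈ univ) =>
        (by positivity : (0 : ℝ) ≤ ((commutingPoints η π).card : ℝ) + 8))
    linarith
  simp only [← pow_two] at h1
  rw [sum_const, nsmul_eq_mul] at h3
  rw [h1]
  rw [h4] at h5
  have h6 := mul_le_mul_of_nonneg_left hW
    (Nat.cast_nonneg (α := ℝ) (univ.filter fun x => η x = x).card)
  linarith only [h3, h5, h6, hW]

theorem sum_consecutivePairs_eq (η : Perm α) :
    ∑ π, consecutivePairs η π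
      = ∑ x ∈ univ.filter (fun x => η x ≠ x), ∑ y ∈ univ.filter (fun y => η y ≠ y),
        (((arcMaps η x y).filter fun π => π (η (η x)) = η (η y)).card : ℝ) := by
  unfold consecutivePairs
  rw [sum_comm]
  refine sum_congr rfl fun x hx => ?_
  have h := sum_sum_arcMaps η (by simpa using hx)
    (fun π => if η x ∈ commutingPoints η π then (1 : ℝ) else 0) (x := x)
  simp only [ite_and]
  rw [← h]
  refine sum_congr rfl fun y _ => ?_
  rw [card_filter]
  push_cast
  refine sum_congr rfl fun π hπ => ?_
  simp only [mem_commutingPoints, (mem_arcMaps.mp hπ).2]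

/-- If neither `x` nor `y` lies in a 2-cycle, three images are prescribed, and at most `n²` such
pairs contribute `O(1/n)`. If both do, the third condition is automatic and the probability is
`1/(n(n-1))`, but there are only `t²` pairs, `t` being the number of points in 2-cycles. The mixed
case is impossible. -/
theorem sum_consecutivePairs_le (η : Perm α) (hn : 4 ≤ Fintype.card α) :
    Fintype.card α * ∑ π, consecutivePairs η π
      ≤ (3 + ((univ.filter fun x => η x ≠ x ∧ η (η x) = x).card : ℝ) ^ 2)
        * Fintype.card (Perm α) := by
  set n := (Fintype.card α : ℝ) with hn'
  set N := (Fintype.card (Perm α) : ℝ) with hN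
  set S := univ.filter (fun x => η x ≠ x) with hS
  have h4 : (4 : ℝ) ≤ n := by rw [hn']; exact_mod_cast hn
  have hN0 : 0 ≤ N := by positivity
  have hP : 0 < n * (n - 1) := mul_pos (by linarith) (by linarith)
  have hP' : 0 < n * (n - 1) * (n - 2) := mul_pos hP (by linarith)
  have key : ∀ x ∈ S, ∀ y ∈ S,
      (((arcMaps η x y).filter fun π => π (η (η x)) = η (η y)).card : ℝ)
      ≤ N / (n * (n - 1) * (n - 2)) + N / (n * (n - 1)) *
        ((if η (η x) = x then 1 else 0) * (if η (η y) = y then 1 else 0)) := by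
    intro x hx y hy
    have hx' : η x ≠ x := by simpa [hS] using hx
    have hy' : η y ≠ y := by simpa [hS] using hy
    have hA : 0 ≤ N / (n * (n - 1) * (n - 2)) := by positivity
    have hempty (h : ¬ (η (η x) = x ↔ η (η y) = y)) :
        (arcMaps η x y).filter (fun π => π (η (η x)) = η (η y)) = ∅ := by
      rw [filter_eq_empty_iff]
      intro π hπ h1
      have h0 := (mem_arcMaps.mp hπ).1
      refine h ⟨fun h2 => ?_, fun h2 => ?_⟩
      · rw [h2, h0] at h1; exact h1.symm
      · rw [h2] at h1; exact π.injective (h1.trans h0.symm)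
    by_cases h1 : η (η x) = x <;> by_cases h2 : η (η y) = y
    · have h5 := card_arcMaps η hx' hy'
      have h6 : (((arcMaps η x y).filter fun π => π (η (η x)) = η (η y)).card : ℝ)
          ≤ (arcMaps η x y).card := by exact_mod_cast card_le_card (filter_subset _ _)
      have h7 : ((arcMaps η x y).card : ℝ) = N / (n * (n - 1)) := by
        rw [eq_div_iff hP.ne', mul_comm]; exact h5
      rw [if_pos h1, if_pos h2]
      linarith
    · rw [hempty (by tauto)]; simp [h2, hA]
    · rw [hempty (by tauto)]; simp [h1, hA]
    · have h5 := card_arcMaps_filter η hx' hy' h1 h2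
      rw [if_neg h1, if_neg h2, mul_zero, mul_zero, add_zero, le_div_iff₀ hP', mul_comm]
      exact h5.le
  have hm : (S.card : ℝ) ≤ n := by
    rw [hn']; exact_mod_cast (card_le_card (filter_subset _ _)).trans_eq card_univ
  have hT : ∑ x ∈ S, (if η (η x) = x then (1 : ℝ) else 0)
      = (univ.filter fun x => η x ≠ x ∧ η (η x) = x).card := by
    rw [← sum_filter, hS, filter_filter, sum_const, nsmul_eq_mul, mul_one]
  set t := ((univ.filter fun x => η x ≠ x ∧ η (η x) = x).card : ℝ) with ht
  have h5 : ∑ π, consecutivePairs η π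
      ≤ (S.card : ℝ) ^ 2 * (N / (n * (n - 1) * (n - 2))) + N / (n * (n - 1)) * t ^ 2 := by
    rw [sum_consecutivePairs_eq]
    refine (sum_le_sum fun x hx => sum_le_sum fun y hy => key x hx y hy).trans (le_of_eq ?_)
    simp only [sum_add_distrib, ← mul_sum, sum_const, nsmul_eq_mul]
    rw [← sum_mul, hT]
    ring
  have h6 : n * ((S.card : ℝ) ^ 2 * (N / (n * (n - 1) * (n - 2)))) ≤ 3 * N := by
    have h7 : (S.card : ℝ) ^ 2 ≤ n ^ 2 := by gcongr
    -- This inequality needs `n ≥ 4`.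
    have h8 : n ^ 2 ≤ 3 * ((n - 1) * (n - 2)) := by nlinarith
    have h9 : n * ((S.card : ℝ) ^ 2 * (N / (n * (n - 1) * (n - 2))))
        = (S.card : ℝ) ^ 2 * N / ((n - 1) * (n - 2)) := by
      have : n ≠ 0 := by linarith
      field_simp
    have h10 : 0 < (n - 1) * (n - 2) := mul_pos (by linarith) (by linarith)
    rw [h9, div_le_iff₀ h10]
    nlinarith [mul_le_mul_of_nonneg_right (h7.trans h8) hN0]
  have h7 : n * (N / (n * (n - 1)) * t ^ 2) ≤ t ^ 2 * N := by
    have h9 : n * (N / (n * (n - 1)) * t ^ 2) = t ^ 2 * N / (n - 1) := by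
      have : n ≠ 0 := by linarith
      field_simp
    rw [h9]
    exact div_le_self (by positivity) (by linarith)
  have h8 := mul_le_mul_of_nonneg_left h5 (by linarith : 0 ≤ n)
  linarith

/-! ### The approximate Stein identity -/

/-- The constant in the approximate Stein identity for the number of commuting points, in terms
of the numbers of fixed points and of points in `2`-cycles. -/
noncomputable def steinConstant (F t : ℝ) : ℝ :=
  2 * (2 * F + 1) + F ^ 2 + 4 * (8 * (2 + F) + 2 * (3 + t ^ 2) + 4 * ((2 + F) ^ 2 + 16))

theorem steinConstant_mono {F F' t t' : ℝ} (hF : 0 ≤ F) (ht : 0 ≤ t) (hF' : F ≤ F')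
    (ht' : t ≤ t') : steinConstant F t ≤ steinConstant F' t' := by
  unfold steinConstant; gcongr

theorem steinConstant_nonneg {F t : ℝ} (hF : 0 ≤ F) : 0 ≤ steinConstant F t := by
  unfold steinConstant; positivity

/-- Distinct integers differ by at least 1, so boundedness of `f` already gives a Lipschitz bound.
-/
theorem abs_sub_le_mul_abs_natCast_sub {f : ℕ → ℝ} {B : ℝ} (hf : ∀ k, |f k| ≤ B) (j k : ℕ) :
    |f j - f k| ≤ 2 * B * |(j : ℝ) - k| := by
  rcases eq_or_ne j k with rfl | h
  · simp
  have h1 : (1 : ℝ) ≤ |(j : ℝ) - k| := by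
    have : 1 ≤ |(j : ℤ) - k| := Int.one_le_abs (sub_ne_zero.mpr (by exact_mod_cast h))
    exact_mod_cast this
  have h2 := abs_sub (f j) (f k)
  have h3 : 0 ≤ B := (abs_nonneg _).trans (hf j)
  nlinarith [hf j, hf k]

theorem card_mul_abs_stein_le (η : Perm α) (hn : 4 ≤ Fintype.card α) {f : ℕ → ℝ} {B : ℝ}
    (hf : ∀ k, |f k| ≤ B) :
    Fintype.card α * |∑ π, (f ((commutingPoints η π).card + 1)
      - (commutingPoints η π).card * f (commutingPoints η π).card)|
      ≤ B * steinConstant (univ.filter fun x => η x = x).card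
          (univ.filter fun x => η x ≠ x ∧ η (η x) = x).card * Fintype.card (Perm α) := by
  have hW := sum_card_commutingPoints_le η (by omega)
  have hW2 := sum_sq_card_commutingPoints_le η (by omega)
  have hQ := sum_consecutivePairs_le η hn
  have hR := sum_abs_card_commutingPoints_sub_le η
  have hfix := card_mul_sum_fixed η
  have hdec := sum_card_commutingPoints_mul η (fun π => f (commutingPoints η π).card)
  have h1 := mul_sum_sum_arcMaps η (fun π => f (commutingPoints η π).card)
  have h2 := sum_sum_swap_mul η (fun π => f ((commutingPoints η π).card + 1))
  have hB : 0 ≤ B := (abs_nonneg _).trans (hf 0)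
  have hsplit := card_filter_add_card_filter_not (s := (univ : Finset α)) (fun x => η x = x)
  set F := ((univ.filter fun x => η x = x).card : ℝ) with hF
  set t := ((univ.filter fun x => η x ≠ x ∧ η (η x) = x).card : ℝ) with ht
  set N := (Fintype.card (Perm α) : ℝ) with hN
  set n := (Fintype.card α : ℝ) with hn'
  have hm : ((univ.filter fun x => η x ≠ x).card : ℝ) = n - F := by
    rw [hn', hF, ← card_univ, ← hsplit]; push_cast; ring
  have hFn : F ≤ n := by
    have : (0 : ℝ) ≤ ((univ.filter fun x => η x ≠ x).card : ℝ) := by positivity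
    linarith
  have hF0 : 0 ≤ F := by positivity
  have h4 : (4 : ℝ) ≤ n := by rw [hn']; exact_mod_cast hn
  have hN0 : 0 ≤ N := by positivity
  have hP : 0 < n * (n - 1) := mul_pos (by linarith) (by linarith)
  set X := ∑ x ∈ univ.filter (fun x => η x ≠ x), ∑ y ∈ univ.filter (fun y => η y ≠ y),
    ∑ π ∈ arcMaps η x y, f (commutingPoints η π).card with hX
  set Y := ∑ π, f ((commutingPoints η π).card + 1) with hY
  set Z := ∑ x ∈ univ.filter (fun x => η x = x), ∑ π,
          if x ∈ commutingPoints η π then f (commutingPoints η π).card else 0 with hZ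
  have hXY : |n * (n - 1) * X - (n - F) ^ 2 * Y|
      ≤ 2 * B * (n * N * (8 * (2 + F) + 2 * (3 + t ^ 2) + 4 * ((2 + F) ^ 2 + 16))) := by
    have h5 : |n * (n - 1) * X - (n - F) ^ 2 * Y| ≤ 2 * B *
        (8 * n * ∑ π, ((commutingPoints η π).card : ℝ) + 2 * n ^ 2 * ∑ π, consecutivePairs η π
          + 4 * n * ∑ π, ((commutingPoints η π).card : ℝ) ^ 2) := by
      refine le_trans ?_ (mul_le_mul_of_nonneg_left hR (by positivity))
      rw [h1, ← hm, ← h2]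
      simp only [← sum_sub_distrib, mul_sum]
      refine (abs_sum_le_sum_abs _ _).trans (sum_le_sum fun x _ => ?_)
      refine (abs_sum_le_sum_abs _ _).trans (sum_le_sum fun y _ => ?_)
      refine (abs_sum_le_sum_abs _ _).trans (sum_le_sum fun u _ => ?_)
      refine (abs_sum_le_sum_abs _ _).trans (sum_le_sum fun v _ => ?_)
      refine (abs_sum_le_sum_abs _ _).trans (sum_le_sum fun π _ => ?_)
      have := abs_sub_le_mul_abs_natCast_sub hf (commutingPoints η π).card
        ((commutingPoints η (swap y u * (swap (η y) v * π))).card + 1)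
      push_cast at this
      exact this
    refine h5.trans (mul_le_mul_of_nonneg_left ?_ (by positivity))
    have h6 := mul_le_mul_of_nonneg_left hW (by positivity : 0 ≤ n)
    have h7 := mul_le_mul_of_nonneg_left hW2 (by positivity : 0 ≤ n)
    have h8 := mul_le_mul_of_nonneg_left hQ (by positivity : 0 ≤ n)
    linarith only [h6, h7, h8]
  have hYB : |Y| ≤ B * N := by
    refine (abs_sum_le_sum_abs _ _).trans ((sum_le_sum fun π _ => hf _).trans (le_of_eq ?_))
    simp [hN, mul_comm]
  have hZB : n * |Z| ≤ B * (F ^ 2 * N) := by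
    rw [← hfix, ← mul_assoc, mul_comm B n, mul_assoc]
    refine mul_le_mul_of_nonneg_left ?_ (by positivity)
    rw [mul_sum]
    refine (abs_sum_le_sum_abs _ _).trans (sum_le_sum fun x _ => ?_)
    rw [mul_sum]
    refine (abs_sum_le_sum_abs _ _).trans (sum_le_sum fun π _ => ?_)
    split_ifs
    · simpa using hf _
    · simp
  rw [sum_sub_distrib, hdec]
  set C := 8 * (2 + F) + 2 * (3 + t ^ 2) + 4 * ((2 + F) ^ 2 + 16) with hC
  have hC0 : 0 ≤ C := by positivity
  have hYX : |Y - X| * (n * (n - 1)) ≤ (2 * F + 1) * n * (B * N) + 2 * B * (n * N * C) := by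
    -- The first term is the cost of having `(n - F)²` pairs instead of `n(n-1)`; the second is the
    -- coupling error.
    have e : (Y - X) * (n * (n - 1))
        = (n * (n - 1) - (n - F) ^ 2) * Y - (n * (n - 1) * X - (n - F) ^ 2 * Y) := by ring
    have e2 : |n * (n - 1) - (n - F) ^ 2| ≤ (2 * F + 1) * n := by
      have h5 := mul_nonneg hF0 (sub_nonneg.mpr hFn)
      have h6 := mul_nonneg hF0 (hF0.trans hFn)
      rw [abs_le]
      constructor <;> linarith only [h5, h6, h4, mul_self_nonneg F]
    have habs : |Y - X| * (n * (n - 1)) = |(Y - X) * (n * (n - 1))| := by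
      rw [abs_mul, abs_of_pos hP]
    rw [habs, e]
    refine (abs_sub _ _).trans (add_le_add ?_ hXY)
    rw [abs_mul]
    exact mul_le_mul e2 hYB (abs_nonneg _) (by positivity)
  -- The outer factor 2 comes from `n ≤ 2 (n - 1)`. With the 2 of the Lipschitz bound it makes the 4
  -- in `steinConstant`.
  have hYX2 : n * |Y - X| ≤ 2 * ((2 * F + 1) * (B * N) + 2 * B * (N * C)) := by
    have h5 : |Y - X| * (n - 1) ≤ (2 * F + 1) * (B * N) + 2 * B * (N * C) := by
      have : 0 < n := by linarith
      refine le_of_mul_le_mul_left ?_ this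
      linarith only [hYX]
    have h6 : |Y - X| * n ≤ |Y - X| * (2 * (n - 1)) :=
      mul_le_mul_of_nonneg_left (by linarith) (abs_nonneg _)
    linarith only [h5, h6]
  have h9 : |Y - (X + Z)| ≤ |Y - X| + |Z| := by
    rw [← sub_sub]; exact abs_sub _ _
  have h10 := mul_le_mul_of_nonneg_left h9 (by positivity : 0 ≤ n)
  unfold steinConstant
  rw [← hC]
  linarith only [h10, hYX2, hZB]

end Combinatorics

/-! ### The Stein equation for Poisson(1) -/

section SteinEquation

open Finset
open scoped Nat

/-- The solution `f` of the Stein equation `f (k + 1) - k * f k = g k` for `Poisson(1)`. -/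
def steinSolution (g : ℕ → ℝ) : ℕ → ℝ
  -- The equation multiplies this value by `k = 0`, so it is arbitrary.
  | 0 => 0
  | k + 1 => k * steinSolution g k + g k

theorem steinSolution_succ_sub (g : ℕ → ℝ) (k : ℕ) :
    steinSolution g (k + 1) - k * steinSolution g k = g k := by
  simp [steinSolution]

theorem steinSolution_succ (g : ℕ → ℝ) (k : ℕ) :
    steinSolution g (k + 1) = k ! * ∑ j ∈ range (k + 1), g j / j ! := by
  induction k with
  | zero => simp [steinSolution]
  | succ k ih =>
    have h : ((k + 1)! : ℝ) ≠ 0 := by positivity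
    rw [steinSolution, ih, sum_range_succ _ (k + 1), mul_add, mul_div_cancel₀ _ h,
      Nat.factorial_succ]
    push_cast
    ring

/-- As `g` has Poisson mean zero, the partial sum in `steinSolution_succ` is minus a tail. Since `k!
/ (j + k + 1)! ≤ 1 / j!`, that tail times `k!` is at most `e < 3`. -/
theorem abs_steinSolution_le {g : ℕ → ℝ} (hg : ∀ k, |g k| ≤ 1)
    (h0 : HasSum (fun j => g j / j !) 0) (k : ℕ) : |steinSolution g k| ≤ 3 := by
  cases k with
  | zero => simp [steinSolution]
  | succ k =>
    have htail := (hasSum_nat_add_iff' (k + 1)).mpr h0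
    rw [zero_sub] at htail
    have hexp : HasSum (fun j : ℕ => (1 : ℝ) / j !) (Real.exp 1) := by
      have := NormedSpace.expSeries_div_hasSum_exp (1 : ℝ)
      simpa [← Real.exp_eq_exp_ℝ] using this
    have hle : ∀ j : ℕ, |(k ! : ℝ) * (g (j + (k + 1)) / (j + (k + 1))!)| ≤ 1 / j ! := by
      intro j
      have h1 : ((j ! * k ! : ℕ) : ℝ) ≤ ((j + (k + 1))! : ℕ) := by
        have h2 := Nat.le_of_dvd (Nat.factorial_pos _) (Nat.factorial_mul_factorial_dvd_factorial_add j k)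
        exact_mod_cast h2.trans (Nat.factorial_le (by omega))
      have h3 : (0 : ℝ) < (j + (k + 1))! := by positivity
      have h4 : (0 : ℝ) < j ! := by positivity
      have h5 : (0 : ℝ) < k ! := by positivity
      rw [abs_mul, abs_div, abs_of_pos h3, abs_of_pos h5, ← mul_div_assoc, div_le_div_iff₀ h3 h4]
      push_cast at h1
      nlinarith [hg (j + (k + 1)), mul_pos h4 h5]
    have hs := htail.mul_left (k ! : ℝ)
    have h1 : |(k ! : ℝ) * -∑ j ∈ range (k + 1), g j / j !| ≤ Real.exp 1 := by
      rw [abs_le]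
      exact ⟨hasSum_le (fun j => (abs_le.mp (hle j)).1) hexp.neg hs,
        hasSum_le (fun j => (abs_le.mp (hle j)).2) hs hexp⟩
    rw [mul_neg, abs_neg, ← steinSolution_succ] at h1
    exact h1.trans Real.exp_one_lt_three.le

theorem hasSum_indicator_sub_poissonMeasure (A : Set ℕ) :
    HasSum (fun j : ℕ => (A.indicator 1 j - (poissonMeasure 1).real A) / j !) (0 : ℝ) := by
  have h1 : HasSum (fun j : ℕ => (Real.exp (-1) * 1 ^ j / j !) • A.indicator (1 : ℕ → ℝ) j)
      ((poissonMeasure 1).real A) := by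
    have hA : MeasurableSet A := MeasurableSet.of_discrete
    have h := hasSum_integral_poissonMeasure (r := 1) (f := A.indicator (1 : ℕ → ℝ))
      ((integrable_const (1 : ℝ)).indicator hA)
    rw [integral_indicator_one hA] at h
    simpa using h
  have h2 := (hasSum_one_poissonMeasure 1).mul_right ((poissonMeasure 1).real A)
  rw [one_mul] at h2
  have h3 := (h1.sub h2).mul_left (Real.exp 1)
  rw [sub_self, mul_zero] at h3
  refine h3.congr_fun fun j => ?_
  have he : Real.exp 1 * Real.exp (-1) = 1 := by rw [← Real.exp_add]; simp
  simp only [NNReal.coe_one, one_pow, mul_one, smul_eq_mul]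
  linear_combination (-(A.indicator 1 j - (poissonMeasure 1).real A) / (j ! : ℝ)) * he

end SteinEquation

/-! ### Transfer to the law of the fixed-point count -/

section Law

open Finset Equiv

/-- Each point counted lies in the support of its own cycle, which is a transposition. -/
theorem card_two_cycle_points_le {n : ℕ} (η : Perm (Fin n)) :
    (univ.filter fun x => η x ≠ x ∧ η (η x) = x).card ≤ 2 * numTwoCycles η := by
  have hsub : (univ.filter fun x => η x ≠ x ∧ η (η x) = x) ⊆
      (η.cycleFactorsFinset.filter fun c => c.support.card = 2).biUnion fun c => c.support := by
    intro x hx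
    simp only [mem_filter, mem_univ, true_and] at hx
    have hm : η.cycleOf x ∈ η.cycleFactorsFinset :=
      Perm.cycleOf_mem_cycleFactorsFinset_iff.mpr (Perm.mem_support.mpr hx.1)
    simp only [mem_biUnion, mem_filter]
    refine ⟨η.cycleOf x, ⟨hm, ?_⟩, ?_⟩
    · have h1 : η.cycleOf x x = η x := Perm.cycleOf_apply_self η x
      have h2 : η.cycleOf x (η x) = x := by
        rw [Perm.cycleOf_apply_apply_self, hx.2]
      have h3 := (Perm.isCycle_cycleOf η hx.1).eq_swap_of_apply_apply_eq_self (x := x)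
        (by rw [h1]; exact hx.1) (by rw [h1, h2])
      rw [h3, h1]
      exact Perm.card_support_swap (Ne.symm hx.1)
    · rw [Perm.mem_support_cycleOf_iff]
      exact ⟨Perm.SameCycle.refl _ _, Perm.mem_support.mpr hx.1⟩
  refine (card_le_card hsub).trans ((card_biUnion_le).trans ?_)
  rw [sum_congr rfl fun c hc => (mem_filter.mp hc).2, sum_const, smul_eq_mul, mul_comm,
    numTwoCycles, Perm.cycleType_def, Multiset.count_map]
  refine Nat.mul_le_mul_left 2 (le_of_eq ?_)
  rw [card_def, filter_val]
  simp [eq_comm]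

theorem numFixedPoints_permCommutator {n : ℕ} (η π : Perm (Fin n)) :
    numFixedPoints (permCommutator η π) = (commutingPoints η π).card := by
  unfold numFixedPoints commutingPoints
  congr 1
  refine filter_congr fun x _ => ?_
  change η⁻¹ (π⁻¹ (η (π x))) = x ↔ _
  rw [Perm.inv_eq_iff_eq, Perm.inv_eq_iff_eq, eq_comm]

instance {n : ℕ} (η : Perm (Fin n)) : IsProbabilityMeasure (commutatorFixedPointsLaw η) := by
  unfold commutatorFixedPointsLaw; infer_instance

theorem commutatorFixedPointsLaw_real {n : ℕ} (η : Perm (Fin n)) (A : Set ℕ) :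
    (Fintype.card (Perm (Fin n)) : ℝ) * (commutatorFixedPointsLaw η).real A
      = ∑ π, A.indicator (1 : ℕ → ℝ) (commutingPoints η π).card := by
  classical
  rw [measureReal_def, commutatorFixedPointsLaw,
    PMF.toMeasure_apply_eq_toOuterMeasure, PMF.toOuterMeasure_map_apply,
    PMF.toOuterMeasure_uniformOfFintype_apply, ENNReal.toReal_div]
  have h : (Fintype.card (Perm (Fin n)) : ℝ) ≠ 0 := by positivity
  simp only [ENNReal.toReal_natCast]
  rw [mul_div_cancel₀ _ h, Fintype.card_subtype]
  simp [numFixedPoints_permCommutator, Set.indicator_apply]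

theorem tvDist_le_of_forall {α : Type*} [MeasurableSpace α] {μ ν : Measure α} {c : ℝ}
    (h : ∀ A, MeasurableSet A → |μ.real A - ν.real A| ≤ c) : tvDist μ ν ≤ c := by
  have : Nonempty {A : Set α // MeasurableSet A} := ⟨⟨∅, MeasurableSet.empty⟩⟩
  exact ciSup_le fun A => h A A.2

theorem tvDist_le_one {α : Type*} [MeasurableSpace α] (μ ν : Measure α)
    [IsProbabilityMeasure μ] [IsProbabilityMeasure ν] : tvDist μ ν ≤ 1 := by
  refine tvDist_le_of_forall fun A _ => ?_
  have h1 : μ.real A ≤ 1 := measureReal_le_one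
  have h2 : ν.real A ≤ 1 := measureReal_le_one
  have h3 : 0 ≤ μ.real A := measureReal_nonneg
  have h4 : 0 ≤ ν.real A := measureReal_nonneg
  exact abs_le.mpr ⟨by linarith, by linarith⟩

theorem card_mul_abs_law_sub_poisson_le {n : ℕ} (η : Perm (Fin n)) (hn : 4 ≤ n) (A : Set ℕ) :
    n * |(commutatorFixedPointsLaw η).real A - (poissonMeasure 1).real A|
      ≤ 3 * steinConstant (univ.filter fun x => η x = x).card
          (univ.filter fun x => η x ≠ x ∧ η (η x) = x).card := by
  set p := (poissonMeasure 1).real A with hp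
  set g : ℕ → ℝ := fun j => A.indicator 1 j - p with hg
  have hp0 : 0 ≤ p := measureReal_nonneg
  have hp1 : p ≤ 1 := measureReal_le_one
  have hg1 : ∀ k, |g k| ≤ 1 := by
    intro k
    by_cases hk : k ∈ A
    · simp only [hg, Set.indicator_of_mem hk, Pi.one_apply]
      exact abs_le.mpr ⟨by linarith, by linarith⟩
    · simp only [hg, Set.indicator_of_notMem hk]
      exact abs_le.mpr ⟨by linarith, by linarith⟩
  have hf := abs_steinSolution_le hg1 (hasSum_indicator_sub_poissonMeasure A)
  have h := card_mul_abs_stein_le η (by simpa using hn) hf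
  simp only [steinSolution_succ_sub] at h
  have hN : (0 : ℝ) < Fintype.card (Perm (Fin n)) := by exact_mod_cast Fintype.card_pos
  have h2 : ∑ π, g (commutingPoints η π).card
      = Fintype.card (Perm (Fin n)) * ((commutatorFixedPointsLaw η).real A - p) := by
    simp only [hg, sum_sub_distrib, mul_sub, commutatorFixedPointsLaw_real]
    simp
  rw [h2, abs_mul, abs_of_pos hN, Fintype.card_fin] at h
  refine le_of_mul_le_mul_left ?_ hN
  linarith

end Law

theorem mainTheorem4 (a b : ℝ) (ha : 0 < a) (hb : 0 < b) :
    ∃ K : ℝ, ∀ (n : ℕ), 0 < n → ∀ η : Equiv.Perm (Fin n),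
      (numFixedPoints η : ℝ) ≤ a → (numTwoCycles η : ℝ) ≤ b →
        tvDist (commutatorFixedPointsLaw η) (poissonMeasure 1) ≤ K / (n : ℝ) := by
  -- The 4 covers `n < 4`, where the distance is at most `1 ≤ 4 / n`; the 3 bounds the Stein
  -- solution; `2 * b` bounds the number of points in 2-cycles.
  refine ⟨4 + 3 * steinConstant a (2 * b), fun n hn η hηa hηb => ?_⟩
  have hn0 : (0 : ℝ) < n := by exact_mod_cast hn
  have hK : 0 ≤ steinConstant a (2 * b) := steinConstant_nonneg ha.le
  rcases lt_or_ge n 4 with h4 | h4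
  · refine (tvDist_le_one _ _).trans ?_
    have : (n : ℝ) ≤ 4 := by exact_mod_cast h4.le
    rw [le_div_iff₀ hn0]
    linarith
  · refine tvDist_le_of_forall fun A _ => ?_
    rw [le_div_iff₀ hn0, mul_comm]
    refine (card_mul_abs_law_sub_poisson_le η h4 A).trans ?_
    have ht : ((Finset.univ.filter fun x => η x ≠ x ∧ η (η x) = x).card : ℝ) ≤ 2 * b := by
      have : ((Finset.univ.filter fun x => η x ≠ x ∧ η (η x) = x).card : ℝ)
        ≤ 2 * numTwoCycles η := by exact_mod_cast card_two_cycle_points_le η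
      linarith
    have := steinConstant_mono (Nat.cast_nonneg _) (Nat.cast_nonneg _) hηa ht
    unfold numFixedPoints at this
    linarith
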